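/- Let $\mu$ be the Borel probability measure on $\mathbb{R}$ with $\mu(E)=\frac12\left(\mu(\tau_0^{-1}E)+\mu(\tau_2^{-1}E)\right)$ for all Borel sets $E$, where $\tau_0(x)=x/4$ and $\tau_2(x)=(x+2)/4$. An odd natural number $m$ is called complete if the exponentials $e^{2\pi i\lambda x}$, $\lambda\in\Gamma(m)=\left\{\sum_{k=0}^n4^kl_k : l_k\in\{0,m\},\ n\in\mathbb{N}\right\}$, form an orthonormal basis of $L^2(\mu)$, and incomplete otherwise; $m$ is called primitive if it is incomplete and all its proper divisors are complete. A finite set $C=\{x_0,\dots,x_{r-1}\}\subset\mathbb{R}$, $r\ge1$, is an extreme cycle for the digits $\{0,m\}$ if there are $l_0,\dots,l_{r-1}\in\{0,m\}$ such that $x_{k+1}=\frac{x_k+l_k}{4}$ for all $k$ (indices modulo $r$) and $\left|\frac{1+e^{2\pi i\,2x_k}}{2}\right|=1$ for all $k$; its length is the number of its elements. Let $o_4(m)$ be the smallest integer $a\geq1$ with $4^a\equiv1\pmod m$, and let $G_m$ be the subgroup generated by $4$ in the group of units $U(\mathbb{Z}_m)$ of $\mathbb{Z}_m=\mathbb{Z}/m\mathbb{Z}$.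 **Proposition 3.5.** Let $m$ be a primitive number and let $C$ be an extreme cycle for the digits $\{0,m\}$ other than the trivial one, $C\neq\{0\}$. Then: 1. The length of $C$ is equal to $o_4(m)$. 2. Every element of $C$ is a nonnegative integer that is coprime to $m$. 3. $C$ is a coset of $G_m$ in $U(\mathbb{Z}_m)$: for every $x_0\in C$ one has $C=x_0G_m$, where elements of $\mathbb{Z}_m$ are identified with their representatives in $\{0,\dots,m-1\}$. -/

import Mathlib

open MeasureTheory
open scoped Pointwise

namespace CantorSpectrum

/-! ### The invariant measure of the Cantor set with scale `4` and digits `{0, 2}` -/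

/-- The fair coin on `Bool`. -/
noncomputable def coin : Measure Bool :=
  (2⁻¹ : ENNReal) • (Measure.dirac false + Measure.dirac true)

/-- The digit of a coin toss: `0` or `2`. -/
def digit (b : Bool) : ℝ := if b then 2 else 0

/-- The real number `∑_{k ≥ 1} 4⁻ᵏ bₖ` with base-four digits `bₖ ∈ {0, 2}`. -/
noncomputable def expansion (b : ℕ → Bool) : ℝ := ∑' k : ℕ, digit (b k) / 4 ^ (k + 1)

theorem isProbabilityMeasure_coin : IsProbabilityMeasure coin := by
  constructor
  simp only [coin, Measure.smul_apply, Measure.add_apply, measure_univ, smul_eq_mul]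
  rw [one_add_one_eq_two]
  exact ENNReal.inv_mul_cancel (by norm_num) (by norm_num)

attribute [instance] isProbabilityMeasure_coin

/-- The Cantor measure: the law of `∑_{k ≥ 1} 4⁻ᵏ bₖ` where the digits `bₖ` are independent and
uniformly distributed on `{0, 2}`. The theorems `isProbabilityMeasure_cantorMeasure` and
`cantorMeasure_invariant` below show that it is a Borel probability measure that
satisfies the invariance equation of the iterated function system `x / 4`, `(x + 2) / 4`
(which has exactly one such measure). -/
noncomputable def cantorMeasure : Measure ℝ :=
  (Measure.infinitePi (fun _ : ℕ => coin)).map expansion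

theorem digit_bound (b : Bool) (k : ℕ) :
    ‖digit b / 4 ^ (k + 1)‖ ≤ (1 / 2 : ℝ) * (1 / 4) ^ k := by
  have h : |digit b| ≤ 2 := by cases b <;> simp [digit]
  rw [Real.norm_eq_abs, abs_div, abs_of_pos (by positivity : (0 : ℝ) < 4 ^ (k + 1)), pow_succ,
    one_div_pow, div_le_iff₀ (by positivity)]
  have : (4 : ℝ) ^ k ≠ 0 := by positivity
  field_simp
  linarith

theorem summable_bound : Summable (fun k : ℕ => (1 / 2 : ℝ) * (1 / 4) ^ k) :=
  (summable_geometric_of_lt_one (by norm_num) (by norm_num)).mul_left _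

theorem summable_digit (b : ℕ → Bool) : Summable (fun k : ℕ => digit (b k) / 4 ^ (k + 1)) :=
  Summable.of_norm_bounded summable_bound fun k => digit_bound (b k) k

theorem measurable_expansion : Measurable expansion := by
  apply Continuous.measurable
  refine continuous_tsum (fun k => ?_) summable_bound fun k b => digit_bound (b k) k
  exact (continuous_of_discreteTopology (f := digit)).comp (continuous_apply k) |>.div_const _

theorem isProbabilityMeasure_cantorMeasure : IsProbabilityMeasure cantorMeasure :=
  Measure.isProbabilityMeasure_map measurable_expansion.aemeasurable

attribute [instance] isProbabilityMeasure_cantorMeasure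

/-- Prepend a toss to a sequence of tosses. -/
def cons (p : Bool × (ℕ → Bool)) : ℕ → Bool := fun n => Nat.casesOn n p.1 p.2

theorem measurable_cons : Measurable cons := by
  refine measurable_pi_lambda _ fun n => ?_
  cases n with
  | zero => exact measurable_fst
  | succ n => exact (measurable_pi_apply n).comp measurable_snd

theorem expansion_cons (a : Bool) (b : ℕ → Bool) :
    expansion (cons (a, b)) = (expansion b + digit a) / 4 := by
  unfold expansion
  rw [(summable_digit _).tsum_eq_zero_add, add_div, ← tsum_div_const, add_comm]
  congr 1
  · refine tsum_congr fun k => ?_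
    simp only [cons]
    rw [pow_succ _ (k + 1), div_mul_eq_div_div]
  · simp [cons]

theorem map_cons : (coin.prod (Measure.infinitePi (fun _ : ℕ => coin))).map cons =
    Measure.infinitePi (fun _ : ℕ => coin) := by
  refine Measure.eq_infinitePi (fun _ : ℕ => coin) fun s t ht => ?_
  classical
  have hpre : cons ⁻¹' Set.pi s t = (if 0 ∈ s then t 0 else Set.univ) ×ˢ
      Set.pi (s.preimage Nat.succ Nat.succ_injective.injOn : Finset ℕ)
        (fun i => t (i + 1)) := by
    ext ⟨a, b⟩
    simp only [Set.mem_preimage, Set.mem_pi, Finset.mem_coe, Set.mem_prod, Finset.mem_preimage]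
    constructor
    · intro h
      refine ⟨?_, fun i hi => h (i + 1) hi⟩
      split_ifs with h0
      · exact h 0 h0
      · trivial
    · rintro ⟨h0, h1⟩ i hi
      cases i with
      | zero => rw [if_pos hi] at h0; exact h0
      | succ i => exact h1 i hi
  rw [Measure.map_apply measurable_cons (MeasurableSet.pi s.countable_toSet fun i _ => ht i),
    hpre, Measure.prod_prod, Measure.infinitePi_pi _ fun i _ => ht (i + 1)]
  have hprod := Finset.prod_preimage' Nat.succ s Nat.succ_injective.injOn
    fun i => coin (t i)
  simp only [Nat.succ_eq_add_one] at hprod ⊢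
  have herase : s.filter (fun i => i ∈ Set.range Nat.succ) = s.erase 0 := by
    ext i
    cases i <;> simp
  rw [hprod]
  split_ifs with h0
  · rw [← Finset.mul_prod_erase s _ h0, ← herase]
  · rw [measure_univ, one_mul, herase, Finset.erase_eq_of_notMem h0]

theorem cantorMeasure_invariant (E : Set ℝ) (hE : MeasurableSet E) :
    cantorMeasure E = 2⁻¹ * (cantorMeasure ((fun x : ℝ => x / 4) ⁻¹' E) +
      cantorMeasure ((fun x : ℝ => (x + 2) / 4) ⁻¹' E)) := by
  have h0 : Measurable fun x : ℝ => x / 4 := by fun_prop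
  have h2 : Measurable fun x : ℝ => (x + 2) / 4 := by fun_prop
  have hS := measurable_cons (measurable_expansion hE)
  conv_lhs => rw [cantorMeasure, ← map_cons]
  rw [Measure.map_apply measurable_expansion hE, Measure.map_apply measurable_cons
    (measurable_expansion hE), Measure.prod_apply hS, cantorMeasure,
    Measure.map_apply measurable_expansion (h0 hE),
    Measure.map_apply measurable_expansion (h2 hE), coin, lintegral_smul_measure,
    lintegral_add_measure, lintegral_dirac, lintegral_dirac, smul_eq_mul]
  simp only [← Set.preimage_comp]
  congr 3 <;> · ext b; simp [expansion_cons, digit]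

/-! ### Spectra, complete numbers and primitive numbers -/

/-- The exponential function `e_t(x) = exp(2πi t x)`. -/
noncomputable def expFun (t : ℝ) (x : ℝ) : ℂ := Complex.exp (2 * Real.pi * Complex.I * (t * x))

/-- `Γ` is a spectrum for `μ`: the exponentials `e_t`, `t ∈ Γ`, form an orthonormal (Hilbert)
basis of the complex Hilbert space `L²(μ)`. -/
def IsSpectrum (μ : Measure ℝ) (Γ : Set ℝ) : Prop :=
  ∃ b : HilbertBasis Γ ℂ (Lp ℂ 2 μ), ∀ t : Γ, (b t : ℝ → ℂ) =ᵐ[μ] expFun t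

/-- The set `Γ(m)` of all finite sums `∑_{k=0}^n 4ᵏ lₖ` with `lₖ ∈ {0, m}`. -/
def gammaSet (m : ℕ) : Set ℝ :=
  {t | ∃ (n : ℕ) (l : ℕ → ℝ), (∀ k, l k = 0 ∨ l k = m) ∧
    t = ∑ k ∈ Finset.range (n + 1), 4 ^ k * l k}

/-- An (odd) number `m` is complete if `Γ(m)` is a spectrum for the Cantor measure. -/
def IsComplete (m : ℕ) : Prop := IsSpectrum cantorMeasure (gammaSet m)

/-- A primitive number: an odd number that is incomplete and has only complete proper divisors. -/
def IsPrimitive (m : ℕ) : Prop :=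
  Odd m ∧ ¬ IsComplete m ∧ ∀ d ∈ m.properDivisors, IsComplete d

/-! ### Extreme cycles -/

/-- `C` is an extreme cycle for the digits `{0, m}`: `C = {x₀, …, x_{r-1}}` (with `r = n + 1 ≥ 1`)
where `x_{k+1} = (x_k + l_k) / 4` with `l_k ∈ {0, m}`, the indices being read cyclically
(addition in `Fin (n + 1)` is modulo `n + 1`), and `|(1 + exp(2πi · 2 x_k)) / 2| = 1`. -/
def IsExtremeCycle (m : ℕ) (C : Set ℝ) : Prop :=
  ∃ (n : ℕ) (x l : Fin (n + 1) → ℝ), C = Set.range x ∧ (∀ k, l k = 0 ∨ l k = m) ∧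
    (∀ k, x (k + 1) = (x k + l k) / 4) ∧
    ∀ k, ‖(1 + Complex.exp (2 * Real.pi * Complex.I * (2 * x k))) / 2‖ = 1

/-! ### The group generated by `4` -/

/-- The order `o₄(m)` of `4` modulo `m`: the least `a ≥ 1` with `4ᵃ ≡ 1 (mod m)`. -/
noncomputable def o4 (m : ℕ) : ℕ := orderOf (4 : ZMod m)

/-- The subgroup `G_m` of the group of units of `ℤ/mℤ` that is generated by `4` (for `m` odd). -/
def G (m : ℕ) : Subgroup (ZMod m)ˣ := Subgroup.closure {u | (u : ZMod m) = 4}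

/-- The representative in `{0, …, m - 1}` of a unit of `ℤ/mℤ`, as a real number. -/
def rep {m : ℕ} (u : (ZMod m)ˣ) : ℝ := ((u : ZMod m).val : ℝ)

end CantorSpectrum

namespace CantorSpectrum

/-! ### Zeros of the Fourier transform of the Cantor measure -/

/-! A nontrivial extreme cycle is a periodic orbit of positive integers at most `m / 3` with `4 * y
(k + 1) ≡ y k` modulo `m` (`IsExtremeCycle.exists_orbit`, `orbit_eq_zero_of_odd`). Any positive
integer orbit makes `m` incomplete: the frequency `-y 0` is orthogonal to all of `Γ(m)`
(`not_isComplete_of_orbit`). If `d = gcd (y 0, m)` exceeded 1, it would divide the whole orbit,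
since `d` is odd; dividing by `d` gives a positive orbit for the proper divisor `m / d`, which
primitivity forbids (`IsPrimitive.coprime_orbit`). So the orbit consists of units modulo `m`, each
step multiplies by the inverse of 4, and the orbit sweeps out a coset of `G m`, whose size is the
order of 4. -/

theorem continuous_expFun (t : ℝ) : Continuous (expFun t) := by
  unfold expFun; fun_prop

theorem norm_expFun (t x : ℝ) : ‖expFun t x‖ = 1 := by
  have : (2 * Real.pi * Complex.I * (t * x) : ℂ) = ((2 * Real.pi * (t * x) : ℝ) : ℂ) * Complex.I := by
    push_cast; ring
  rw [expFun, this, Complex.norm_exp_ofReal_mul_I]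

theorem integrable_expFun (t : ℝ) (μ : Measure ℝ) [IsFiniteMeasure μ] : Integrable (expFun t) μ :=
  Integrable.of_bound (continuous_expFun t).aestronglyMeasurable 1
    (Filter.Eventually.of_forall fun x => (norm_expFun t x).le)

theorem cantorMeasure_eq : cantorMeasure = (2⁻¹ : ENNReal) •
    (cantorMeasure.map (fun x : ℝ => x / 4) + cantorMeasure.map (fun x : ℝ => (x + 2) / 4)) := by
  have h0 : Measurable fun x : ℝ => x / 4 := by fun_prop
  have h2 : Measurable fun x : ℝ => (x + 2) / 4 := by fun_prop
  ext E hE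
  rw [cantorMeasure_invariant E hE, Measure.smul_apply, Measure.add_apply,
    Measure.map_apply h0 hE, Measure.map_apply h2 hE, smul_eq_mul]

/-- Self-similarity of the measure: the branch `(x + 2) / 4` differs from `x / 4` only by the phase
`exp(πit)`. -/
theorem integral_expFun (t : ℝ) : ∫ x, expFun t x ∂cantorMeasure =
    (1 + expFun t (1 / 2)) / 2 * ∫ x, expFun (t / 4) x ∂cantorMeasure := by
  have h0 : Measurable fun x : ℝ => x / 4 := by fun_prop
  have h2 : Measurable fun x : ℝ => (x + 2) / 4 := by fun_prop
  have i0 := Measure.isProbabilityMeasure_map (μ := cantorMeasure) h0.aemeasurable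
  have i2 := Measure.isProbabilityMeasure_map (μ := cantorMeasure) h2.aemeasurable
  conv_lhs => rw [cantorMeasure_eq]
  rw [integral_smul_measure, integral_add_measure (integrable_expFun _ _) (integrable_expFun _ _),
    integral_map h0.aemeasurable (continuous_expFun t).aestronglyMeasurable,
    integral_map h2.aemeasurable (continuous_expFun t).aestronglyMeasurable]
  have e0 : ∀ x : ℝ, expFun t (x / 4) = expFun (t / 4) x := fun x => by
    simp only [expFun]; congr 1; push_cast; ring
  have e2 : ∀ x : ℝ, expFun t ((x + 2) / 4) = expFun t (1 / 2) * expFun (t / 4) x := fun x => by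
    simp only [expFun]; rw [← Complex.exp_add]; congr 1; push_cast; ring
  simp only [e2]
  simp only [e0, integral_const_mul, ENNReal.toReal_inv, ENNReal.toReal_ofNat,
    Complex.real_smul]
  push_cast
  ring

theorem expFun_intCast_half (q : ℤ) : expFun q (1 / 2) = (-1) ^ q := by
  rw [← Complex.exp_pi_mul_I, ← Complex.exp_int_mul, expFun]
  congr 1; push_cast; ring

/-- Each factor 4 is removed by the functional equation; at odd `q` the factor `1 + (-1) ^ q`
vanishes. -/
theorem integral_expFun_four_pow_mul_odd (j : ℕ) {q : ℤ} (hq : Odd q) :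
    ∫ x, expFun ((4 : ℝ) ^ j * q) x ∂cantorMeasure = 0 := by
  induction j with
  | zero => rw [pow_zero, one_mul, integral_expFun, expFun_intCast_half, hq.neg_one_zpow]; simp
  | succ j ih =>
    rw [integral_expFun, show (4 : ℝ) ^ (j + 1) * q / 4 = 4 ^ j * q by ring, ih, mul_zero]

/-! ### Nontrivial cycles obstruct completeness -/

/-- The translates of `Γ(m)` by the points of a nonzero backward orbit `y` of the maps
`x ↦ (x + l) / 4`, `l ∈ {0, m}`, consist of zeros of the Fourier transform. -/
theorem exists_four_pow_mul_odd {m : ℕ} (hm : Odd m) {y : ℕ → ℕ} (hy : ∀ k, 0 < y k)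
    (hstep : ∀ k, 4 * y (k + 1) = y k ∨ 4 * y (k + 1) = y k + m)
    (N : ℕ) (l : ℕ → ℕ) (hl : ∀ k, l k = 0 ∨ l k = m) (k : ℕ) :
    ∃ j q : ℕ, Odd q ∧ y k + ∑ i ∈ Finset.range N, 4 ^ i * l i = 4 ^ j * q := by
  induction N generalizing l k with
  | zero =>
    -- Descent: as long as the digit is 0, the orbit value drops by a factor 4; with digit `m` the
    -- value `4 * y (k + 1) - m` is odd.
    induction h : y k using Nat.strong_induction_on generalizing k with
    | _ a ih =>
      subst h
      rcases hstep k with h | h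
      · obtain ⟨j, q, hq, e⟩ := ih (y (k + 1)) (by have := hy k; omega) (k + 1) rfl
        refine ⟨j + 1, q, hq, ?_⟩
        simp only [Finset.range_zero, Finset.sum_empty, add_zero] at e ⊢
        rw [← h, e]; ring
      · refine ⟨0, y k, ?_, by simp⟩
        rw [Nat.odd_iff] at hm ⊢
        omega
  | succ N ih =>
    obtain ⟨j, q, hq, e⟩ := ih (fun i => l (i + 1)) (fun i => hl (i + 1)) (k + 1)
    have hs : ∑ i ∈ Finset.range (N + 1), 4 ^ i * l i =
        4 * ∑ i ∈ Finset.range N, 4 ^ i * l (i + 1) + l 0 := by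
      rw [Finset.sum_range_succ', Finset.mul_sum, pow_zero, one_mul]
      congr 1
      exact Finset.sum_congr rfl fun i _ => by ring
    rw [hs]
    -- If `l 0` is the digit of the orbit, a factor 4 splits off the whole sum. Otherwise `y k + l
    -- 0` differs by the odd `m` from a multiple of 4, so the sum is odd.
    by_cases h : 4 * y (k + 1) = y k + l 0
    · refine ⟨j + 1, q, hq, ?_⟩
      rw [pow_succ', mul_assoc, ← e]
      omega
    · refine ⟨0, _, ?_, (one_mul _).symm⟩
      rw [Nat.odd_iff] at hm ⊢
      have := hstep k
      have := hl 0
      omega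

/-- The inner product of the exponentials at `-y 0` and `t` is the Fourier transform at `t + y 0`,
which is zero. In a Hilbert basis this would make an exponential, of modulus 1, vanish almost
everywhere. -/
theorem not_isComplete_of_orbit {m : ℕ} (hm : Odd m) {y : ℕ → ℕ} (hy : ∀ k, 0 < y k)
    (hstep : ∀ k, 4 * y (k + 1) = y k ∨ 4 * y (k + 1) = y k + m) : ¬ IsComplete m := by
  rintro ⟨b, hb⟩
  have hmem : MemLp (expFun (-(y 0 : ℝ))) 2 cantorMeasure :=
    MemLp.of_bound (continuous_expFun _).aestronglyMeasurable 1
      (Filter.Eventually.of_forall fun x => (norm_expFun _ x).le)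
  have horth : ∀ t : gammaSet m, inner ℂ (hmem.toLp _) (b t) = 0 := by
    rintro ⟨t, n, l, hl, rfl⟩
    have hl' : ∀ k, ∃ a : ℕ, (a = 0 ∨ a = m) ∧ l k = a := fun k => by
      rcases hl k with h | h
      · exact ⟨0, .inl rfl, by simpa using h⟩
      · exact ⟨m, .inr rfl, h⟩
    choose a ha hla using hl'
    obtain ⟨j, q, hq, e⟩ := exists_four_pow_mul_odd hm hy hstep (n + 1) a ha 0
    rw [L2.inner_def, ← integral_expFun_four_pow_mul_odd j
      (show Odd (q : ℤ) by exact_mod_cast hq)]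
    refine integral_congr_ae ?_
    filter_upwards [hmem.coeFn_toLp, hb ⟨_, n, l, hl, rfl⟩] with x h1 h2
    rw [h1, h2, RCLike.inner_apply]
    have e' : (4 : ℝ) ^ j * ((q : ℤ) : ℝ) =
        y 0 + ∑ k ∈ Finset.range (n + 1), 4 ^ k * l k := by
      simp only [hla]; exact_mod_cast e.symm
    rw [e']
    simp only [expFun]
    rw [← Complex.exp_conj, ← Complex.exp_add]
    congr 1
    simp only [map_mul, Complex.conj_ofReal, Complex.conj_I, map_ofNat]
    push_cast
    ring
  have hzero : hmem.toLp _ = 0 := by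
    rw [← b.repr.map_eq_zero_iff]
    ext t
    rw [b.repr_apply_apply, ← inner_conj_symm, horth]
    simp
  have hae : expFun (-(y 0 : ℝ)) =ᵐ[cantorMeasure] 0 := by
    rw [← MemLp.toLp_eq_toLp_iff hmem MemLp.zero, hzero]; rfl
  obtain ⟨x, hx⟩ := hae.exists
  have := norm_expFun (-(y 0 : ℝ)) x
  rw [hx] at this
  simp at this

/-! ### Structure of extreme cycles -/

/-- Equality in the triangle inequality forces `exp(4πix) = 1`. -/
theorem exists_int_of_norm_eq_one {x : ℝ}
    (h : ‖(1 + Complex.exp (2 * Real.pi * Complex.I * (2 * x))) / 2‖ = 1) :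
    ∃ z : ℤ, 2 * x = z := by
  have e : (2 * Real.pi * Complex.I * (2 * x) : ℂ) =
      ((2 * x * (2 * Real.pi) : ℝ) : ℂ) * Complex.I := by push_cast; ring
  rw [e, norm_div, Complex.norm_ofNat, div_eq_one_iff_eq two_ne_zero] at h
  set θ := 2 * x * (2 * Real.pi)
  have h2 : Complex.normSq (1 + Complex.exp (θ * Complex.I)) = 4 := by
    rw [Complex.normSq_eq_norm_sq, h]; norm_num
  rw [Complex.normSq_apply, Complex.add_re, Complex.add_im, Complex.exp_ofReal_mul_I_re,
    Complex.exp_ofReal_mul_I_im, Complex.one_re, Complex.one_im] at h2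
  have hc : Real.cos θ = 1 := by nlinarith [Real.sin_sq_add_cos_sq θ]
  obtain ⟨z, hz⟩ := (Real.cos_eq_one_iff θ).1 hc
  exact ⟨z, (mul_right_cancel₀ (by positivity) hz).symm⟩

open Fin.CommRing in
theorem IsExtremeCycle.exists_orbit {m : ℕ} {C : Set ℝ} (hC : IsExtremeCycle m C) :
    ∃ (y : ℕ → ℕ) (r : ℕ), 0 < r ∧ C = Set.range (fun k => (y k : ℝ)) ∧
      (∀ k, 4 * y (k + 1) = y k ∨ 4 * y (k + 1) = y k + m) ∧
      (∀ k, y (k + r) = y k) ∧ ∀ k, 3 * y k ≤ m := by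
  obtain ⟨n, x, l, rfl, hl, hx, hnorm⟩ := hC
  -- Half-integrality of the next point suffices, because `x k = 4 * x (k + 1) - l k`.
  have hint : ∀ k, ∃ z : ℤ, x k = z := fun k => by
    obtain ⟨w, hw⟩ := exists_int_of_norm_eq_one (hnorm (k + 1))
    rw [hx k] at hw
    rcases hl k with h | h
    · exact ⟨2 * w, by push_cast; linarith⟩
    · exact ⟨2 * w - m, by push_cast; linarith⟩
  have hpred : ∀ k, x k = (x (k - 1) + l (k - 1)) / 4 := fun k => by
    have := hx (k - 1); rwa [sub_add_cancel] at this
  have hlb : ∀ k, 0 ≤ l k ∧ l k ≤ m := fun k => by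
    rcases hl k with h | h <;> simp [h]
  -- A minimal point is at least a quarter of itself, hence nonnegative; dually, a maximal point `M`
  -- satisfies `4 * M ≤ M + m`.
  have hnonneg : ∀ k, 0 ≤ x k := fun k => by
    obtain ⟨i, hi⟩ := Finite.exists_min x
    linarith [hi k, hi (i - 1), hpred i, (hlb (i - 1)).1]
  have hle : ∀ k, 3 * x k ≤ m := fun k => by
    obtain ⟨i, hi⟩ := Finite.exists_max x
    linarith [hi k, hi (i - 1), hpred i, (hlb (i - 1)).2]
  have hnat : ∀ k, ∃ a : ℕ, x k = a := fun k => by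
    obtain ⟨z, hz⟩ := hint k
    have : 0 ≤ z := by exact_mod_cast hz ▸ hnonneg k
    lift z to ℕ using this
    exact ⟨z, by simpa using hz⟩
  choose a ha using hnat
  refine ⟨fun k => a (k : Fin (n + 1)), n + 1, n.succ_pos, ?_, fun k => ?_, fun k => ?_,
    fun k => ?_⟩
  · ext t
    constructor
    · rintro ⟨k, rfl⟩
      exact ⟨k, by simp [ha]⟩
    · rintro ⟨k, rfl⟩
      exact ⟨k, ha _⟩
  · have := hx (k : Fin (n + 1))
    rw [ha, ha] at this
    push_cast
    rcases hl (k : Fin (n + 1)) with h | h <;> rw [h] at this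
    · left
      exact_mod_cast (by linarith : (4 : ℝ) * a ((k : Fin (n + 1)) + 1) = a (k : Fin (n + 1)))
    · right
      exact_mod_cast (by linarith : (4 : ℝ) * a ((k : Fin (n + 1)) + 1) = a (k : Fin (n + 1)) + m)
  · have : ((k + (n + 1) : ℕ) : Fin (n + 1)) = k := by
      rw [Nat.cast_add, Fin.natCast_self, add_zero]
    simp only [this]
  · have := hle (k : Fin (n + 1))
    rw [ha] at this
    exact_mod_cast this

/-- The successor of 0 is 0, as 4 does not divide the odd `m`. Periodicity lets every index be moved
past `k`. -/
theorem orbit_eq_zero_of_odd {m : ℕ} (hm : Odd m) {y : ℕ → ℕ} {r : ℕ} (hr : 0 < r)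
    (hstep : ∀ k, 4 * y (k + 1) = y k ∨ 4 * y (k + 1) = y k + m)
    (hper : ∀ k, y (k + r) = y k) {k : ℕ} (hk : y k = 0) (i : ℕ) : y i = 0 := by
  have hfwd : ∀ j, y (k + j) = 0 := fun j => by
    induction j with
    | zero => exact hk
    | succ j ih =>
      have := hstep (k + j)
      rw [Nat.odd_iff] at hm
      rw [← add_assoc]
      omega
  have hmul : ∀ j, y (i + r * j) = y i := fun j => by
    induction j with
    | zero => rfl
    | succ j ih => rw [Nat.mul_succ, ← add_assoc, hper, ih]
  obtain ⟨c, hc⟩ := Nat.exists_eq_add_of_le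
    (show k ≤ i + r * k from (Nat.le_mul_of_pos_left k hr).trans (Nat.le_add_left _ _))
  rw [← hmul k, hc, hfwd]

theorem IsPrimitive.coprime_orbit {m : ℕ} (hm : IsPrimitive m) {y : ℕ → ℕ} (hy : ∀ k, 0 < y k)
    (hstep : ∀ k, 4 * y (k + 1) = y k ∨ 4 * y (k + 1) = y k + m) : (y 0).Coprime m := by
  obtain ⟨hodd, -, hdiv⟩ := hm
  by_contra hd
  rw [Nat.Coprime] at hd
  set d := (y 0).gcd m
  have hd0 : 0 < d := Nat.gcd_pos_of_pos_left _ (hy 0)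
  obtain ⟨c, hc⟩ : d ∣ m := Nat.gcd_dvd_right _ _
  have hd4 : d.Coprime 4 := by
    have : d.Coprime 2 := (hodd.of_dvd_nat ⟨c, hc⟩).coprime_two_right
    exact this.mul_right this
  have hdy : ∀ k, d ∣ y k := fun k => by
    induction k with
    | zero => exact Nat.gcd_dvd_left _ _
    | succ k ih =>
      refine hd4.dvd_of_dvd_mul_left ?_
      rcases hstep k with h | h <;> rw [h]
      · exact ih
      · exact ih.add ⟨c, hc⟩
  choose z hz using hdy
  have hcm : c ∈ m.properDivisors := by
    refine Nat.mem_properDivisors.2 ⟨⟨d, by rw [hc, mul_comm]⟩, ?_⟩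
    have : 0 < m := hodd.pos
    have hc0 : 0 < c := Nat.pos_of_ne_zero (by rintro rfl; omega)
    nlinarith [show 2 ≤ d by omega]
  refine not_isComplete_of_orbit (hodd.of_dvd_nat ⟨d, by rw [hc, mul_comm]⟩) (y := z)
    (fun k => ?_) (fun k => ?_) (hdiv c hcm)
  · have := hy k
    rw [hz] at this
    exact Nat.pos_of_mul_pos_left this
  · refine (hstep k).imp (fun h => ?_) (fun h => ?_) <;> refine Nat.eq_of_mul_eq_mul_left hd0 ?_
    · rw [← hz, ← h, hz (k + 1)]; ring
    · rw [mul_add, ← hz, ← hc, ← h, hz (k + 1)]; ring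

/-! ### Orbits as cosets -/

theorem rep_injective (m : ℕ) [NeZero m] : Function.Injective (rep (m := m)) := fun _ _ h =>
  Units.ext (ZMod.val_injective m (Nat.cast_injective h))

theorem G_eq_zpowers {m : ℕ} {v : (ZMod m)ˣ} (hv : (v : ZMod m) = 4) :
    G m = Subgroup.zpowers v := by
  rw [G, Subgroup.zpowers_eq_closure]
  congr 1
  ext u
  rw [Set.mem_ofPred_eq, ← hv, Units.val_inj, Set.mem_singleton_iff]

theorem range_rep_eq_image_coset {m : ℕ} [NeZero m] {v : (ZMod m)ˣ} (hv : (v : ZMod m) = 4)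
    {u : ℕ → (ZMod m)ˣ} (hu : ∀ k, v * u (k + 1) = u k) (k : ℕ) :
    Set.range (fun i => rep (u i)) = rep '' (u k • (G m : Set (ZMod m)ˣ)) := by
  have hpow : ∀ k i, u (k + i) = u k * v⁻¹ ^ i := fun k i => by
    induction i with
    | zero => simp
    | succ i ih =>
      rw [pow_succ, ← mul_assoc, ← ih, ← hu (k + i), ← add_assoc, mul_comm v, mul_inv_cancel_right]
  rw [G_eq_zpowers hv, ← Function.comp_def, Set.range_comp]
  congr 1
  ext w
  rw [Set.mem_smul_set_iff_inv_smul_mem, smul_eq_mul, SetLike.mem_coe]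
  constructor
  · rintro ⟨i, rfl⟩
    -- The index `i` may precede `k`, so both are compared with `u 0`.
    have h0 : ∀ j, u j = u 0 * v⁻¹ ^ j := fun j => by simpa using hpow 0 j
    rw [h0 i, h0 k, mul_inv, mul_mul_mul_comm, inv_mul_cancel, one_mul]
    exact mul_mem (inv_mem (pow_mem (inv_mem (Subgroup.mem_zpowers v)) _))
      (pow_mem (inv_mem (Subgroup.mem_zpowers v)) _)
  -- The unit group is finite, so natural powers of `v⁻¹`, the ones a forward orbit reaches, exhaust
  -- the subgroup.
  · rw [← Subgroup.zpowers_inv, ← mem_powers_iff_mem_zpowers]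
    rintro ⟨i, hi⟩
    refine ⟨k + i, ?_⟩
    rw [hpow]
    simp only at hi
    rw [hi, mul_inv_cancel_left]

theorem ncard_image_coset {m : ℕ} [NeZero m] {v : (ZMod m)ˣ} (hv : (v : ZMod m) = 4)
    (u : (ZMod m)ˣ) : (rep '' (u • (G m : Set (ZMod m)ˣ))).ncard = o4 m := by
  rw [Set.ncard_image_of_injective _ (rep_injective m), ← Set.image_smul,
    Set.ncard_image_of_injective _ (MulAction.injective u), ← Nat.card_coe_set_eq,
    SetLike.coe_sort_coe, G_eq_zpowers hv, Nat.card_zpowers, o4, ← hv, orderOf_units]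

end CantorSpectrum

theorem proposition3p5 (m : ℕ) (hm : CantorSpectrum.IsPrimitive m) (C : Set ℝ)
    (hC : CantorSpectrum.IsExtremeCycle m C) (hC0 : C ≠ {0}) :
    C.ncard = CantorSpectrum.o4 m ∧
    (∀ x ∈ C, ∃ k : ℕ, x = (k : ℝ) ∧ k.Coprime m) ∧
    (∀ x ∈ C, ∃ u : (ZMod m)ˣ, x = CantorSpectrum.rep u ∧
      C = CantorSpectrum.rep '' (u • (CantorSpectrum.G m : Set (ZMod m)ˣ))) := by
  obtain ⟨y, r, hr, rfl, hstep, hper, hle⟩ := hC.exists_orbit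
  have hodd := hm.1
  have : NeZero m := ⟨hodd.pos.ne'⟩
  have hy : ∀ k, 0 < y k := fun k => by
    by_contra h
    have h0 := CantorSpectrum.orbit_eq_zero_of_odd hodd hr hstep hper (k := k) (by omega)
    exact hC0 (by simp [h0])
  have hcop : ∀ k, (y k).Coprime m := fun k => by
    simpa using hm.coprime_orbit (y := fun i => y (k + i)) (fun i => hy _) fun i => hstep (k + i)
  have h4 : Nat.Coprime 4 m :=
    Nat.Coprime.mul_left hodd.coprime_two_left hodd.coprime_two_left
  let v := ZMod.unitOfCoprime 4 h4
  have hv : (v : ZMod m) = 4 := by simp [v]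
  let u := fun k => ZMod.unitOfCoprime (y k) (hcop k)
  -- From `0 < y k` and `3 * y k ≤ m` follows `y k < m`, so `y k` is its own representative.
  have hrep : ∀ k, (y k : ℝ) = CantorSpectrum.rep (u k) := fun k => by
    have h1 := hy k
    have h2 := hle k
    rw [CantorSpectrum.rep, ZMod.coe_unitOfCoprime, ZMod.val_natCast_of_lt (by omega)]
  have hu : ∀ k, v * u (k + 1) = u k := fun k => by
    ext
    rw [Units.val_mul, hv, ZMod.coe_unitOfCoprime, ZMod.coe_unitOfCoprime]
    rcases hstep k with h | h
    · exact_mod_cast congrArg (Nat.cast : ℕ → ZMod m) h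
    · simpa using congrArg (Nat.cast : ℕ → ZMod m) h
  have hcoset : ∀ k, Set.range (fun i => (y i : ℝ)) =
      CantorSpectrum.rep '' (u k • (CantorSpectrum.G m : Set (ZMod m)ˣ)) := fun k => by
    simp only [hrep]
    exact CantorSpectrum.range_rep_eq_image_coset hv hu k
  refine ⟨?_, ?_, ?_⟩
  · rw [hcoset 0, CantorSpectrum.ncard_image_coset hv]
  · rintro _ ⟨k, rfl⟩
    exact ⟨y k, rfl, hcop k⟩
  · rintro _ ⟨k, rfl⟩
    exact ⟨u k, hrep k, hcoset k⟩
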